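/- Let $\mathbb K$ be $\mathbb R$ or $\mathbb C$, and let $\mu$ be a probability measure on $\mathbb R$ all of whose moments are finite. Definitions. A function $\phi(z,x)$, $z\in\mathbb K$, $x\in\mathbb R$, is a pre-generating function for $\mu$ if $\phi(z,x)=\sum_{n\ge 0}S_n(x)z^n$ (for each $x$, for all $z$ close to $0$), where $S_n$ is a polynomial over $\mathbb K$ of degree $n$ and $\limsup_n\|S_n\|_{L^2(\mu)}<\infty$; it is a generating function for $\mu$ if moreover the $S_n$ are pairwise orthogonal in $L^2(\mu)$. The multiplicative renormalization method applies for $\mu$ with $h(x)=(1-x)^{-1}$ if there is a $\mathbb K$-valued function $\rho$, analytic around $0$ in $\mathbb K$, with $\rho(0)=0$ and $\rho'(0)\ne 0$, such that $\phi(z,x)=(1-\rho(z)x)^{-1}$ is a pre-generating function for $\mu$, is $\mu$-integrable in $x$ for all $z$ close to $0$, and $$\psi(z,x)=\frac{(1-\rho(z)x)^{-1}}{\int_{\mathbb R}(1-\rho(z)y)^{-1}\,\mu(dy)}$$ is a generating function for $\mu$. Real numbers $\alpha_n$ $(n\ge 0)$ and $\omega_n\ge 0$ $(n\ge 1)$ are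 Jacobi–Szegő parameters of $\mu$ if the monic polynomials defined by $P_{-1}=0$, $P_0=1$, $xP_n=P_{n+1}+\alpha_nP_n+\omega_nP_{n-1}$ are pairwise orthogonal with respect to $\mu$; if $\mu$ has finite support, $P_n$ may vanish $\mu$-almost everywhere, and it is required that $\omega_{n+1}=0$ whenever $\omega_n=0$. The measure $\mu$ is a free Meixner distribution if it has Jacobi–Szegő parameters such that $\alpha_n$ is constant for $n\ge 1$ and $\omega_n$ is constant for $n\ge 2$. It is the standard free Meixner distribution of parameters $a\in\mathbb R$, $b\ge -1$ if it has the Jacobi–Szegő parameters $\alpha_0=0$, $\alpha_n=a$ for $n\ge1$, $\omega_1=1$, $\omega_n=1+b$ for $n\ge 2$. Theorem. The multiplicative renormalization method applies for $\mu$ with $h(x)=(1-x)^{-1}$ if and only if $\mu$ is a free Meixner distribution. If moreover $\mu$ has mean $0$ and variance $1$, then the method applies for $\mu$ with $h(x)=(1-x)^{-1}$ if and only if, for some $a\in\mathbb R$ and $b\ge -1$, $\mu$ is the standard free Meixner distribution of parameters $a,b$. -/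

import Mathlib

open MeasureTheory Filter Topology Polynomial

noncomputable section

/-- `S` is a sequence of polynomials with `deg S n = n` and `limsup ‖S n‖_{L²(μ)} < ∞` such that
`φ z x = ∑ₙ S n (x) zⁿ`: for each real `x` the series converges to `φ z x` for all `z` close
to `0`. -/
structure IsPreGeneratingFunction {𝕜 : Type*} [RCLike 𝕜] (μ : Measure ℝ) (φ : 𝕜 → ℝ → 𝕜)
    (S : ℕ → 𝕜[X]) : Prop where
  degree_eq : ∀ n, (S n).degree = n
  limsup_lt_top : limsup (fun n => eLpNorm (fun x : ℝ => (S n).eval (x : 𝕜)) 2 μ) atTop < ⊤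
  hasSum : ∀ x : ℝ, ∀ᶠ z in 𝓝 (0 : 𝕜), HasSum (fun n => (S n).eval (x : 𝕜) * z ^ n) (φ z x)

/-- `φ` is a pre-generating function for `μ` whose coefficient polynomials are pairwise orthogonal
in `L²(μ)`. -/
def IsGeneratingFunction {𝕜 : Type*} [RCLike 𝕜] (μ : Measure ℝ) (φ : 𝕜 → ℝ → 𝕜) : Prop :=
  ∃ Q : ℕ → 𝕜[X], IsPreGeneratingFunction μ φ Q ∧
    ∀ m n, m ≠ n →
      ∫ x : ℝ, (Q m).eval (x : 𝕜) * (starRingEnd 𝕜) ((Q n).eval (x : 𝕜)) ∂μ = 0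

/-- The multiplicative renormalization `φ(z, x) / E[φ(z, X)]`, where `X` has law `μ`. -/
def multiplicativeRenormalization {𝕜 : Type*} [RCLike 𝕜] (μ : Measure ℝ) (φ : 𝕜 → ℝ → 𝕜) :
    𝕜 → ℝ → 𝕜 :=
  fun z x => φ z x / ∫ y, φ z y ∂μ

/-- The multiplicative renormalization method applies for `μ` with the function `h`: for some
`ρ` analytic around `0` with `ρ(0) = 0`, `ρ'(0) ≠ 0`, the function `φ(z, x) = h(ρ(z) x)` is a
pre-generating function for `μ`, integrable in `x` for small `z`, and its multiplicative
renormalization is a generating function for `μ`. -/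
def MultiplicativeRenormalizationApplies {𝕜 : Type*} [RCLike 𝕜] (μ : Measure ℝ)
    (h : 𝕜 → 𝕜) : Prop :=
  ∃ ρ : 𝕜 → 𝕜, AnalyticAt 𝕜 ρ 0 ∧ ρ 0 = 0 ∧ deriv ρ 0 ≠ 0 ∧
    (∃ S : ℕ → 𝕜[X], IsPreGeneratingFunction μ (fun z x => h (ρ z * (x : 𝕜))) S) ∧
    (∀ᶠ z in 𝓝 (0 : 𝕜), Integrable (fun x : ℝ => h (ρ z * (x : 𝕜))) μ) ∧
    IsGeneratingFunction μ (multiplicativeRenormalization μ fun z x => h (ρ z * (x : 𝕜)))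

/-- `α 0, α 1, …` and `ω 1, ω 2, …` are Jacobi–Szegő parameters of `μ` (`ω 0` plays no role): the
monic polynomials `P n` given by the three-term recurrence
`x P_n = P_{n+1} + α_n P_n + ω_n P_{n-1}`, `P_0 = 1`, `P_{-1} = 0`, are orthogonal with respect
to `μ`. If `μ` has infinite support, all `ω n`, `n ≥ 1`, are then positive; if `μ` has exactly `N`
atoms and no other mass, then `ω n > 0` for `1 ≤ n < N` and `ω n = 0` for `n ≥ N`. -/
def HasJacobiParameters (μ : Measure ℝ) (α ω : ℕ → ℝ) : Prop :=
  (∀ n, 1 ≤ n → 0 ≤ ω n) ∧ (∀ n, 1 ≤ n → ω n = 0 → ω (n + 1) = 0) ∧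
  ∃ P : ℕ → ℝ[X], P 0 = 1 ∧ X * P 0 = P 1 + C (α 0) * P 0 ∧
    (∀ n, X * P (n + 1) = P (n + 2) + C (α (n + 1)) * P (n + 1) + C (ω (n + 1)) * P n) ∧
    ∀ m n, m ≠ n → ∫ x, (P m).eval x * (P n).eval x ∂μ = 0

/-- Free Meixner distributions, not necessarily standard: `α n` is constant from rank `1` on
and `ω n` is constant from rank `2` on. -/
def IsFreeMeixner (μ : Measure ℝ) : Prop :=
  ∃ α ω : ℕ → ℝ, HasJacobiParameters μ α ω ∧
    (∃ α' : ℝ, ∀ n, 1 ≤ n → α n = α') ∧ ∃ ω' : ℝ, ∀ n, 2 ≤ n → ω n = ω'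

/-- The standard (mean `0`, variance `1`) free Meixner distribution of parameters `a`, `b`. -/
def IsStandardFreeMeixner (a b : ℝ) (μ : Measure ℝ) : Prop :=
  -1 ≤ b ∧ ∃ α ω : ℕ → ℝ, HasJacobiParameters μ α ω ∧
    α 0 = 0 ∧ (∀ n, 1 ≤ n → α n = a) ∧ ω 1 = 1 ∧ ∀ n, 2 ≤ n → ω n = 1 + b

end

/-! Necessity. The renormalized kernel satisfies ψ(z,x) = ψ(z,0) + xρ(z)ψ(z,x). Comparing
coefficients of zⁿ⁺¹ and making the polynomials monic gives P_{n+1} = x ∑_j r_j P_{n-j} + γ_n with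
r_0 = 1, where the r_j do not depend on n. Only r_1 and r_2 matter: modulo degree ≤ k, xP_{k+2} -
P_{k+3} is a combination of xP_{k+1} and xP_k, hence, by the preceding three-term relation, of
P_{k+2} and P_{k+1} with the coefficients -r_1 and r_1² - r_2. The difference has degree ≤ k and is
orthogonal to P_0, …, P_k, so it vanishes when these have nonzero norm
(`isFreeMeixner_of_convolution_recurrence`). If ‖P_2‖ = 0, the measure sits on at most two points
and parameters with ω = 0 are found directly (`isFreeMeixner_of_polyInner_two_eq_zero`).

Sufficiency. With D(w) = 1 + αw + ωw² and E(w) = 1 + (α-α₀)w + (ω-ω₁)w², the recurrence gives ∑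
P_n(x)wⁿ = E/(D - wx). For ρ = w/D one has (1 - ρx)⁻¹ = D/(D - wx), which is the same kind of series
with α₀ = ω₁ = 0. Orthogonality to 1 makes the integral of ∑ P_n wⁿ equal to 1, so the integral of
(1 - ρx)⁻¹ is D/E (`eventually_integral_inv_one_sub`) and the renormalization is exactly ∑ P_n wⁿ.
Both families grow at most geometrically in L², so a rescaling of w makes their norms bounded.

In the standardized case, orthogonality to 1 identifies α₀ with the mean and ω₁ with the variance.
-/

/-! ### Power series near 0 and the convolution recurrence. -/

theorem hasFPowerSeriesAt_ofScalars_of_hasSum {𝕜 : Type*} [RCLike 𝕜] {a : ℕ → 𝕜} {f : 𝕜 → 𝕜}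
    (ha : ∀ᶠ z in 𝓝 (0 : 𝕜), HasSum (fun n => a n * z ^ n) (f z)) :
    HasFPowerSeriesAt f (FormalMultilinearSeries.ofScalars 𝕜 a) 0 := by
  rw [hasFPowerSeriesAt_iff]
  filter_upwards [ha] with z hz
  simpa [FormalMultilinearSeries.coeff_ofScalars, mul_comm] using hz

/-- Power series coefficients are determined by the sum near `0`. -/
theorem coeff_eq_of_eventually_hasSum {𝕜 : Type*} [RCLike 𝕜] {a b : ℕ → 𝕜} {f : 𝕜 → 𝕜}
    (ha : ∀ᶠ z in 𝓝 (0 : 𝕜), HasSum (fun n => a n * z ^ n) (f z))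
    (hb : ∀ᶠ z in 𝓝 (0 : 𝕜), HasSum (fun n => b n * z ^ n) (f z)) (n : ℕ) : a n = b n := by
  have h := (hasFPowerSeriesAt_ofScalars_of_hasSum ha).eq_formalMultilinearSeries
    (hasFPowerSeriesAt_ofScalars_of_hasSum hb)
  have := congrArg (fun p => FormalMultilinearSeries.coeff p n) h
  simpa [FormalMultilinearSeries.coeff_ofScalars] using this

theorem eventually_summable_norm_of_eventually_hasSum {𝕜 : Type*} [RCLike 𝕜] {a : ℕ → 𝕜}
    {f : 𝕜 → 𝕜} (ha : ∀ᶠ z in 𝓝 (0 : 𝕜), HasSum (fun n => a n * z ^ n) (f z)) :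
    ∀ᶠ z in 𝓝 (0 : 𝕜), Summable fun n => ‖a n * z ^ n‖ := by
  obtain ⟨w, hw, hw0⟩ := (ha.filter_mono nhdsWithin_le_nhds |>.and
    (self_mem_nhdsWithin : {0}ᶜ ∈ 𝓝[≠] (0 : 𝕜))).exists
  have hw0' : 0 < ‖w‖ := norm_pos_iff.2 hw0
  filter_upwards [Metric.ball_mem_nhds (0 : 𝕜) hw0'] with z hz
  rw [mem_ball_zero_iff] at hz
  obtain ⟨K, hK⟩ := hw.summable.tendsto_atTop_zero.norm.bddAbove_range
  refine Summable.of_nonneg_of_le (fun _ => norm_nonneg _) (fun n => ?_)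
    ((summable_geometric_of_lt_one (by positivity) ((div_lt_one hw0').2 hz)).mul_left K)
  have h1 : ‖a n * w ^ n‖ ≤ K := hK ⟨n, rfl⟩
  calc ‖a n * z ^ n‖ = ‖a n * w ^ n‖ * (‖z‖ / ‖w‖) ^ n := by
        rw [norm_mul, norm_mul, norm_pow, norm_pow, div_pow]
        field_simp
    _ ≤ K * (‖z‖ / ‖w‖) ^ n := by gcongr

theorem eventually_hasSum_mul {𝕜 : Type*} [RCLike 𝕜] {a b : ℕ → 𝕜} {f g : 𝕜 → 𝕜}
    (ha : ∀ᶠ z in 𝓝 (0 : 𝕜), HasSum (fun n => a n * z ^ n) (f z))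
    (hb : ∀ᶠ z in 𝓝 (0 : 𝕜), HasSum (fun n => b n * z ^ n) (g z)) :
    ∀ᶠ z in 𝓝 (0 : 𝕜),
      HasSum (fun n => (∑ k ∈ Finset.range (n + 1), a k * b (n - k)) * z ^ n) (f z * g z) := by
  filter_upwards [ha, hb, eventually_summable_norm_of_eventually_hasSum ha,
    eventually_summable_norm_of_eventually_hasSum hb] with z h1 h2 h3 h4
  have h := hasSum_sum_range_mul_of_summable_norm h3 h4
  rw [h1.tsum_eq, h2.tsum_eq] at h
  convert h using 2 with n
  rw [Finset.sum_mul]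
  refine Finset.sum_congr rfl fun k hk => ?_
  rw [← Nat.add_sub_of_le (Nat.lt_succ_iff.1 (Finset.mem_range.1 hk)), pow_add,
    Nat.add_sub_cancel_left]
  ring

theorem polynomial_eq_of_forall_real_eval_eq {𝕜 : Type*} [RCLike 𝕜] {p q : 𝕜[X]}
    (h : ∀ x : ℝ, p.eval (x : 𝕜) = q.eval (x : 𝕜)) : p = q := by
  refine Polynomial.eq_of_infinite_eval_eq p q
    ((Set.infinite_range_of_injective (RCLike.ofReal_injective (K := 𝕜))).mono ?_)
  rintro _ ⟨x, rfl⟩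
  exact h x

/-- The coefficients of a multiplicative renormalization of `(1 - ρ(z) x)⁻¹` satisfy a convolution
recurrence. -/
theorem exists_convolution_recurrence {𝕜 : Type*} [RCLike 𝕜] {ρ m : 𝕜 → 𝕜} {Q : ℕ → 𝕜[X]}
    (hρ : AnalyticAt 𝕜 ρ 0) (hρ0 : ρ 0 = 0)
    (hQ : ∀ x : ℝ, ∀ᶠ z in 𝓝 (0 : 𝕜),
      HasSum (fun n => (Q n).eval (x : 𝕜) * z ^ n) ((1 - ρ z * (x : 𝕜))⁻¹ / m z)) :
    ∃ r : ℕ → 𝕜, r 0 = deriv ρ 0 ∧ ∀ n, Q (n + 1) =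
      X * ∑ j ∈ Finset.range (n + 1), C (r j) * Q (n - j) + C ((Q (n + 1)).eval 0) := by
  obtain ⟨p, hp⟩ := hρ
  have hp0 : p.coeff 0 = 0 := by
    have := hp.coeff_zero (fun _ => 1)
    rw [hρ0] at this
    exact this
  have hps : ∀ᶠ z in 𝓝 (0 : 𝕜), HasSum (fun n => p.coeff n * z ^ n) (ρ z) := by
    filter_upwards [hasFPowerSeriesAt_iff.1 hp] with z hz
    simpa [mul_comm] using hz
  refine ⟨fun j => p.coeff (j + 1), by simpa using hp.deriv.symm, fun n => ?_⟩
  refine polynomial_eq_of_forall_real_eval_eq fun x => ?_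
  have hx := hQ x
  have h0 := hQ 0
  have hne : ∀ᶠ z in 𝓝 (0 : 𝕜), 1 - ρ z * (x : 𝕜) ≠ 0 := by
    have hc : ContinuousAt (fun z => 1 - ρ z * (x : 𝕜)) 0 :=
      continuousAt_const.sub (hp.continuousAt.mul continuousAt_const)
    exact hc.eventually_ne (by simp [hρ0])
  have hmul := eventually_hasSum_mul hps hx
  -- From (1 - u)⁻¹ = 1 + u(1 - u)⁻¹ with u = ρ(z)x; the remaining term 1/m(z) is the same series at
  -- x = 0, which is how the constants Q_n(0) enter.
  have hsum : ∀ᶠ z in 𝓝 (0 : 𝕜), HasSum (fun n => ((Q n).eval 0 +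
      x * ∑ k ∈ Finset.range (n + 1), p.coeff k * (Q (n - k)).eval (x : 𝕜)) * z ^ n)
      ((1 - ρ z * (x : 𝕜))⁻¹ / m z) := by
    filter_upwards [h0, hmul, hne] with z h1 h2 h3
    have h4 := h1.add (h2.mul_left (x : 𝕜))
    have h5 : (1 - ρ z * ((0 : ℝ) : 𝕜))⁻¹ / m z + x * (ρ z * ((1 - ρ z * (x : 𝕜))⁻¹ / m z)) =
        (1 - ρ z * (x : 𝕜))⁻¹ / m z := by
      have h6 : (1 - ρ z * (x : 𝕜))⁻¹ = 1 + ρ z * x * (1 - ρ z * (x : 𝕜))⁻¹ := by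
        field_simp
        ring
      conv_rhs => rw [h6]
      simp
      ring
    rw [h5] at h4
    refine h4.congr_fun fun n => ?_
    simp
    ring
  have := coeff_eq_of_eventually_hasSum hx hsum (n + 1)
  -- The split-off term k = 0 carries the factor ρ(0) = 0, so Q_{n+1} drops out of the sum.
  rw [this, Finset.sum_range_succ']
  simp [hp0, Polynomial.eval_finsetSum, add_comm]

/-! ### Orthogonality of polynomials with respect to μ. -/

/-- The sesquilinear form `∫ p q̄ dμ` on polynomials. -/
noncomputable def polyInner {𝕜 : Type*} [RCLike 𝕜] (μ : Measure ℝ) (p q : 𝕜[X]) : 𝕜 :=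
  ∫ x : ℝ, p.eval (x : 𝕜) * (starRingEnd 𝕜) (q.eval (x : 𝕜)) ∂μ

theorem integrable_eval_ofReal {𝕜 : Type*} [RCLike 𝕜] {μ : Measure ℝ}
    (hμ : ∀ n : ℕ, Integrable (fun x : ℝ => x ^ n) μ) (p : 𝕜[X]) :
    Integrable (fun x : ℝ => p.eval (x : 𝕜)) μ := by
  induction p using Polynomial.induction_on' with
  | add p q hp hq =>
    simp only [eval_add]
    exact hp.add hq
  | monomial n a =>
    have := ((hμ n).ofReal (𝕜 := 𝕜)).const_mul a
    simpa using this

theorem integrable_eval_mul_conj {𝕜 : Type*} [RCLike 𝕜] {μ : Measure ℝ}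
    (hμ : ∀ n : ℕ, Integrable (fun x : ℝ => x ^ n) μ) (p q : 𝕜[X]) :
    Integrable (fun x : ℝ => p.eval (x : 𝕜) * (starRingEnd 𝕜) (q.eval (x : 𝕜))) μ := by
  have h := integrable_eval_ofReal hμ (p * q.map (starRingEnd 𝕜))
  refine h.congr (ae_of_all _ fun x => ?_)
  have : (starRingEnd 𝕜) (q.eval (x : 𝕜)) = (q.map (starRingEnd 𝕜)).eval (x : 𝕜) := by
    rw [← Polynomial.eval_map_apply, RCLike.conj_ofReal]
  simp [this]

section polyInner

variable {𝕜 : Type*} [RCLike 𝕜] {μ : Measure ℝ}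

theorem polyInner_conj_symm (p q : 𝕜[X]) :
    (starRingEnd 𝕜) (polyInner μ p q) = polyInner μ q p := by
  simp only [polyInner]
  rw [← integral_conj]
  simp [mul_comm]

theorem polyInner_C_mul_left (c : 𝕜) (p q : 𝕜[X]) :
    polyInner μ (C c * p) q = c * polyInner μ p q := by
  simp only [polyInner]
  rw [← integral_const_mul]
  simp [mul_assoc]

theorem polyInner_C_mul_right (c : 𝕜) (p q : 𝕜[X]) :
    polyInner μ p (C c * q) = (starRingEnd 𝕜) c * polyInner μ p q := by
  rw [← polyInner_conj_symm, polyInner_C_mul_left, map_mul, polyInner_conj_symm]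

/-- The measure lives on the real line, so multiplication by x is symmetric; this is also what later
forces the parameters to be real when 𝕜 = ℂ. -/
theorem polyInner_X_mul (p q : 𝕜[X]) :
    polyInner μ (X * p) q = polyInner μ p (X * q) := by
  simp only [polyInner]
  congr 1 with x
  simp
  ring

theorem polyInner_add_left (hμ : ∀ n : ℕ, Integrable (fun x : ℝ => x ^ n) μ) (p q r : 𝕜[X]) :
    polyInner μ (p + q) r = polyInner μ p r + polyInner μ q r := by
  simp only [polyInner]
  rw [← integral_add (integrable_eval_mul_conj hμ p r) (integrable_eval_mul_conj hμ q r)]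
  simp [add_mul]

theorem polyInner_add_right (hμ : ∀ n : ℕ, Integrable (fun x : ℝ => x ^ n) μ) (p q r : 𝕜[X]) :
    polyInner μ p (q + r) = polyInner μ p q + polyInner μ p r := by
  rw [← polyInner_conj_symm, polyInner_add_left hμ, map_add, polyInner_conj_symm,
    polyInner_conj_symm]

theorem polyInner_sub_left (hμ : ∀ n : ℕ, Integrable (fun x : ℝ => x ^ n) μ) (p q r : 𝕜[X]) :
    polyInner μ (p - q) r = polyInner μ p r - polyInner μ q r := by
  have := polyInner_add_left hμ (p - q) q r
  rw [sub_add_cancel] at this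
  rw [this, add_sub_cancel_right]

theorem polyInner_self (p : 𝕜[X]) :
    polyInner μ p p = ((∫ x : ℝ, ‖p.eval (x : 𝕜)‖ ^ 2 ∂μ : ℝ) : 𝕜) := by
  simp only [polyInner, RCLike.mul_conj]
  rw [← integral_ofReal]
  simp

theorem ae_eval_eq_zero_of_polyInner_self_eq_zero
    (hμ : ∀ n : ℕ, Integrable (fun x : ℝ => x ^ n) μ) {p : 𝕜[X]} (h : polyInner μ p p = 0) :
    ∀ᵐ x : ℝ ∂μ, p.eval (x : 𝕜) = 0 := by
  rw [polyInner_self, RCLike.ofReal_eq_zero, integral_eq_zero_iff_of_nonneg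
    (fun x => by positivity)] at h
  · filter_upwards [h] with x hx
    simpa using hx
  · have := (integrable_eval_mul_conj hμ p p).norm
    refine this.congr (ae_of_all _ fun x => ?_)
    simp [pow_two]

theorem polyInner_map_ofReal (p q : ℝ[X]) :
    polyInner μ (p.map (algebraMap ℝ 𝕜)) (q.map (algebraMap ℝ 𝕜)) =
      ((∫ x, p.eval x * q.eval x ∂μ : ℝ) : 𝕜) := by
  simp only [polyInner]
  rw [← integral_ofReal]
  congr 1 with x
  have : ∀ p : ℝ[X], (p.map (algebraMap ℝ 𝕜)).eval (x : 𝕜) = (p.eval x : ℝ) := fun p => by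
    rw [← RCLike.algebraMap_eq_ofReal, Polynomial.eval_map_apply]
  simp [this]

/-- A polynomial is a multiple of the monic polynomial of its degree plus lower order terms. -/
theorem natDegree_sub_leadingCoeff_mul {P : ℕ → 𝕜[X]} (hP : ∀ n, (P n).Monic)
    (hd : ∀ n, (P n).natDegree = n) {q : 𝕜[X]} (hq : q ≠ 0) :
    (q - C q.leadingCoeff * P q.natDegree).degree < q.natDegree := by
  rw [← degree_eq_natDegree hq]
  refine degree_sub_lt_left ?_ hq ?_
  · rw [degree_C_mul (by simpa using hq), degree_eq_natDegree (hP _).ne_zero, hd,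
      degree_eq_natDegree hq]
  · simp [hP q.natDegree |>.leadingCoeff]

/-- Subtracting multiples of the monic P_j removes leading terms one at a time. No norm is divided
by, so the argument also covers P_j that vanish almost everywhere. -/
theorem polyInner_eq_zero_of_degree_lt (hμ : ∀ n : ℕ, Integrable (fun x : ℝ => x ^ n) μ)
    {P : ℕ → 𝕜[X]} (hP : ∀ n, (P n).Monic) (hd : ∀ n, (P n).natDegree = n)
    (ho : ∀ m n, m ≠ n → polyInner μ (P m) (P n) = 0) (n : ℕ) :
    ∀ (k : ℕ), k ≤ n → ∀ q : 𝕜[X], q.degree < k → polyInner μ q (P n) = 0 := by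
  intro k
  induction k with
  | zero =>
    intro _ q hq
    have : q = 0 := by simpa using hq
    simp [this, polyInner]
  | succ k ih =>
    intro hk q hq
    by_cases h0 : q = 0
    · simp [h0, polyInner]
    have hqk : q.natDegree < k + 1 := (natDegree_lt_iff_degree_lt h0).2 hq
    have h1 := ih (by omega) _ ((natDegree_sub_leadingCoeff_mul hP hd h0).trans_le
      (by exact_mod_cast Nat.lt_succ_iff.1 hqk))
    rw [polyInner_sub_left hμ, polyInner_C_mul_left, ho _ _ (by omega)] at h1
    simpa using h1

/-- For q of degree d, the pairing with P_d equals the leading coefficient times ‖P_d‖²; nonzero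
norms therefore turn orthogonality into an identity of polynomials, not just an almost everywhere
one. -/
theorem eq_zero_of_polyInner_eq_zero (hμ : ∀ n : ℕ, Integrable (fun x : ℝ => x ^ n) μ)
    {P : ℕ → 𝕜[X]} (hP : ∀ n, (P n).Monic) (hd : ∀ n, (P n).natDegree = n)
    (ho : ∀ m n, m ≠ n → polyInner μ (P m) (P n) = 0) {k : ℕ}
    (hh : ∀ j, j ≤ k → polyInner μ (P j) (P j) ≠ 0) {q : 𝕜[X]} (hq : q.natDegree ≤ k)
    (hz : ∀ j, j ≤ k → polyInner μ q (P j) = 0) : q = 0 := by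
  by_contra h0
  have h1 := polyInner_eq_zero_of_degree_lt hμ hP hd ho q.natDegree q.natDegree le_rfl _
    (natDegree_sub_leadingCoeff_mul hP hd h0)
  rw [polyInner_sub_left hμ, polyInner_C_mul_left, hz _ hq] at h1
  have h2 := hh _ hq
  simp [h0, h2] at h1

end polyInner

/-! ### Free Meixner polynomials and parameters. -/

/-- The monic polynomials whose Jacobi–Szegő parameters are `α₀, α, α, …` and `ω₁, ω, ω, …`. -/
noncomputable def freeMeixnerPoly {R : Type*} [CommRing R] (α₀ α ω₁ ω : R) : ℕ → R[X]
  | 0 => 1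
  | 1 => X - C α₀
  | 2 => (X - C α) * (X - C α₀) - C ω₁
  | n + 3 => (X - C α) * freeMeixnerPoly α₀ α ω₁ ω (n + 2) -
      C ω * freeMeixnerPoly α₀ α ω₁ ω (n + 1)

theorem eq_freeMeixnerPoly {R : Type*} [CommRing R] {α₀ α ω₁ ω : R} {P : ℕ → R[X]}
    (h0 : P 0 = 1) (h1 : P 1 = X - C α₀) (h2 : X * P 1 = P 2 + C α * P 1 + C ω₁ * P 0)
    (h3 : ∀ n, X * P (n + 2) = P (n + 3) + C α * P (n + 2) + C ω * P (n + 1)) (n : ℕ) :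
    P n = freeMeixnerPoly α₀ α ω₁ ω n := by
  induction n using Nat.strong_induction_on with
  | _ n ih =>
    match n with
    | 0 => exact h0
    | 1 => exact h1
    | 2 =>
      rw [freeMeixnerPoly, ← h1]
      rw [h0] at h2
      linear_combination -h2
    | n + 3 =>
      rw [freeMeixnerPoly, ← ih (n + 2) (by omega), ← ih (n + 1) (by omega)]
      linear_combination -h3 n

theorem map_freeMeixnerPoly {R S : Type*} [CommRing R] [CommRing S] (f : R →+* S)
    (α₀ α ω₁ ω : R) (n : ℕ) : (freeMeixnerPoly α₀ α ω₁ ω n).map f =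
      freeMeixnerPoly (f α₀) (f α) (f ω₁) (f ω) n := by
  refine eq_freeMeixnerPoly (P := fun n => (freeMeixnerPoly α₀ α ω₁ ω n).map f) ?_ ?_ ?_ ?_ n
  · simp [freeMeixnerPoly]
  · simp [freeMeixnerPoly]
  · simp [freeMeixnerPoly]
    ring
  · intro n
    simp [freeMeixnerPoly]
    ring

theorem hasJacobiParameters_of_freeMeixnerPoly {μ : Measure ℝ} {α₀ α ω₁ ω : ℝ} (h1 : 0 ≤ ω₁)
    (h2 : 0 ≤ ω) (h12 : ω₁ = 0 → ω = 0)
    (ho : ∀ m n, m ≠ n → ∫ x, (freeMeixnerPoly α₀ α ω₁ ω m).eval x *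
      (freeMeixnerPoly α₀ α ω₁ ω n).eval x ∂μ = 0) :
    HasJacobiParameters μ (fun n => if n = 0 then α₀ else α)
      (fun n => if n ≤ 1 then ω₁ else ω) := by
  refine ⟨fun n _ => ?_, fun n hn => ?_, freeMeixnerPoly α₀ α ω₁ ω, rfl, ?_, fun n => ?_, ho⟩
  · dsimp only
    split_ifs <;> assumption
  · have : ¬ n + 1 ≤ 1 := by omega
    simp only [this, if_false]
    split_ifs
    · exact h12
    · exact id
  · simp [freeMeixnerPoly]
  · cases n <;> simp [freeMeixnerPoly] <;> ring

theorem exists_freeMeixnerPoly_of_isFreeMeixner {μ : Measure ℝ} (h : IsFreeMeixner μ) :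
    ∃ α₀ α ω₁ ω : ℝ, 0 ≤ ω₁ ∧ 0 ≤ ω ∧ (ω₁ = 0 → ω = 0) ∧
      ∀ m n, m ≠ n → ∫ x, (freeMeixnerPoly α₀ α ω₁ ω m).eval x *
        (freeMeixnerPoly α₀ α ω₁ ω n).eval x ∂μ = 0 := by
  obtain ⟨α, ω, ⟨hω, hω0, P, hP0, hP1, hP, ho⟩, ⟨α', hα'⟩, ω', hω'⟩ := h
  have hPe : P = freeMeixnerPoly (α 0) α' (ω 1) ω' := by
    funext n
    refine eq_freeMeixnerPoly hP0 ?_ ?_ ?_ n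
    · rw [hP0] at hP1
      linear_combination -hP1
    · simpa [hα'] using hP 0
    · intro n
      rw [hP (n + 1), hα' _ (by omega), hω' _ (by omega)]
  refine ⟨α 0, α', ω 1, ω', hω 1 le_rfl, hω' 2 le_rfl ▸ hω 2 (by omega), fun h => ?_, hPe ▸ ho⟩
  exact hω' 2 le_rfl ▸ hω0 1 le_rfl h

theorem isFreeMeixner_of_freeMeixnerPoly {μ : Measure ℝ} {α₀ α ω₁ ω : ℝ} (h1 : 0 ≤ ω₁)
    (h2 : 0 ≤ ω) (h12 : ω₁ = 0 → ω = 0)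
    (ho : ∀ m n, m ≠ n → ∫ x, (freeMeixnerPoly α₀ α ω₁ ω m).eval x *
      (freeMeixnerPoly α₀ α ω₁ ω n).eval x ∂μ = 0) : IsFreeMeixner μ :=
  ⟨_, _, hasJacobiParameters_of_freeMeixnerPoly h1 h2 h12 ho, ⟨α, fun n hn => if_neg (by omega)⟩,
    ω, fun n hn => if_neg (by omega)⟩

theorem IsStandardFreeMeixner.isFreeMeixner {a b : ℝ} {μ : Measure ℝ}
    (h : IsStandardFreeMeixner a b μ) : IsFreeMeixner μ := by
  obtain ⟨_, α, ω, hJ, _, hα, _, hω⟩ := h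
  exact ⟨α, ω, hJ, ⟨a, hα⟩, 1 + b, hω⟩

/-- Integrating P_1 and P_2 against 1 yields α₀ = mean and ω₁ = variance; b ≥ -1 is the condition ω
= 1 + b ≥ 0. -/
theorem exists_isStandardFreeMeixner {μ : Measure ℝ} [IsProbabilityMeasure μ]
    (hμ : ∀ n : ℕ, Integrable (fun x : ℝ => x ^ n) μ) (hm : ∫ x, x ∂μ = 0)
    (hv : ∫ x, x ^ 2 ∂μ = 1) (h : IsFreeMeixner μ) : ∃ a b, IsStandardFreeMeixner a b μ := by
  obtain ⟨α₀, α, ω₁, ω, h1, h2, h12, ho⟩ := exists_freeMeixnerPoly_of_isFreeMeixner h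
  have i1 : Integrable (fun x : ℝ => x) μ := by simpa using hμ 1
  have hα₀ : α₀ = 0 := by
    have := ho 1 0 (by omega)
    simp only [freeMeixnerPoly, eval_sub, eval_X, eval_C, eval_one, mul_one] at this
    rw [integral_sub i1 (integrable_const _), hm] at this
    simpa using this
  have hω₁ : ω₁ = 1 := by
    have := ho 2 0 (by omega)
    simp only [freeMeixnerPoly, eval_sub, eval_X, eval_C, eval_one, mul_one, eval_mul, hα₀] at this
    have e : (fun x : ℝ => (x - α) * (x - 0) - ω₁) = fun x => x ^ 2 - α * x - ω₁ := by
      funext x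
      ring
    have i2 : Integrable (fun x : ℝ => x ^ 2 - α * x) μ := (hμ 2).sub (i1.const_mul α)
    rw [e, integral_sub i2 (integrable_const _),
      integral_sub (hμ 2) (i1.const_mul α), integral_const_mul, hm, hv] at this
    simp at this
    linarith
  refine ⟨α, ω - 1, by linarith, _, _, hasJacobiParameters_of_freeMeixnerPoly h1 h2 h12 ho,
    ?_, fun n hn => if_neg (by omega), ?_, fun n hn => ?_⟩
  · simpa using hα₀
  · simpa using hω₁
  · rw [if_neg (by omega)]
    ring

theorem isFreeMeixner_of_polyInner {𝕜 : Type*} [RCLike 𝕜] {μ : Measure ℝ} {α₀ α ω₁ ω : ℝ}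
    (h1 : 0 ≤ ω₁) (h2 : 0 ≤ ω) (h12 : ω₁ = 0 → ω = 0)
    (ho : ∀ m n, m ≠ n → polyInner μ (freeMeixnerPoly (α₀ : 𝕜) α ω₁ ω m)
      (freeMeixnerPoly (α₀ : 𝕜) α ω₁ ω n) = 0) : IsFreeMeixner μ := by
  refine isFreeMeixner_of_freeMeixnerPoly (α₀ := α₀) (α := α) h1 h2 h12 fun m n hmn => ?_
  have := ho m n hmn
  simp only [← RCLike.algebraMap_eq_ofReal, ← map_freeMeixnerPoly, polyInner_map_ofReal] at this
  simpa using this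

theorem exists_polyInner_self_eq_ofReal {𝕜 : Type*} [RCLike 𝕜] {μ : Measure ℝ} (p : 𝕜[X]) :
    ∃ t : ℝ, 0 ≤ t ∧ polyInner μ p p = (t : 𝕜) :=
  ⟨_, integral_nonneg fun _ => by positivity, polyInner_self p⟩

/-! ### Necessity: from the renormalization method to free Meixner. -/

section Forward

variable {𝕜 : Type*} [RCLike 𝕜] {μ : Measure ℝ} [IsProbabilityMeasure μ] {P : ℕ → 𝕜[X]}

theorem polyInner_one_one : polyInner μ (1 : 𝕜[X]) 1 = 1 := by
  simp [polyInner]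

/-- The orthogonal polynomial of degree one. -/
theorem orthogonal_one_eq (hμ : ∀ n : ℕ, Integrable (fun x : ℝ => x ^ n) μ)
    (hP : ∀ n, (P n).Monic) (hd : ∀ n, (P n).natDegree = n)
    (ho : ∀ m n, m ≠ n → polyInner μ (P m) (P n) = 0) :
    P 1 = X - C ((∫ x, x ∂μ : ℝ) : 𝕜) := by
  have h0 : P 0 = 1 := (Monic.natDegree_eq_zero (hP 0)).1 (hd 0)
  have h1 : P 1 = X + C ((P 1).coeff 0) := by
    have h := eq_X_add_C_of_natDegree_le_one (hd 1).le
    have h2 : (P 1).coeff 1 = 1 := by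
      have := (hP 1).coeff_natDegree
      rwa [hd 1] at this
    rw [h2] at h
    simpa using h
  have h3 := ho 1 0 (by omega)
  have h4 : polyInner μ (X : 𝕜[X]) 1 = ((∫ x, x ∂μ : ℝ) : 𝕜) := by
    simp [polyInner, ← integral_ofReal]
  rw [h0, h1, polyInner_add_left hμ, h4, ← mul_one (C _), polyInner_C_mul_left,
    polyInner_one_one, mul_one] at h3
  rw [h1, eq_neg_of_add_eq_zero_right h3, C_neg]
  ring

/-- Here P_2 vanishes almost everywhere, and the given P_n with n > 2 need not satisfy the required
recurrence. They are replaced by the family with ω = 0, in which every polynomial of degree ≥ 2 is a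
multiple of the second and so vanishes almost everywhere. -/
theorem isFreeMeixner_of_polyInner_two_eq_zero
    (hμ : ∀ n : ℕ, Integrable (fun x : ℝ => x ^ n) μ)
    (hP : ∀ n, (P n).Monic) (hd : ∀ n, (P n).natDegree = n)
    (ho : ∀ m n, m ≠ n → polyInner μ (P m) (P n) = 0) (h2 : polyInner μ (P 2) (P 2) = 0) :
    IsFreeMeixner μ := by
  have hP0 : P 0 = 1 := (Monic.natDegree_eq_zero (hP 0)).1 (hd 0)
  have hP1 := orthogonal_one_eq hμ hP hd ho
  set m : ℝ := ∫ x, x ∂μ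
  obtain ⟨v, hv0, hv⟩ := exists_polyInner_self_eq_ofReal (μ := μ) (P 1)
  -- α makes the new quadratic orthogonal to P_1. If v = 0, then P_1 = 0 almost everywhere and any
  -- value would do.
  obtain ⟨α, hα⟩ : ∃ α : ℝ, polyInner μ (X * P 1) (P 1) = α * v := by
    by_cases hv' : v = 0
    · refine ⟨0, ?_⟩
      have := ae_eval_eq_zero_of_polyInner_self_eq_zero hμ (p := P 1) (by simpa [hv'] using hv)
      rw [polyInner, integral_eq_zero_of_ae]
      · simp
      · filter_upwards [this] with x hx
        simp [hx]
    · obtain ⟨t, ht⟩ := RCLike.conj_eq_iff_real.1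
        ((polyInner_conj_symm (μ := μ) (X * P 1) (P 1)).trans (polyInner_X_mul _ _).symm)
      refine ⟨t / v, ?_⟩
      have : (v : 𝕜) ≠ 0 := by simpa using hv'
      rw [ht]
      push_cast
      field_simp
  set p := freeMeixnerPoly (m : 𝕜) α v ((0 : ℝ) : 𝕜)
  have hp2 : p 2 = (X - C (α : 𝕜)) * P 1 - C (v : 𝕜) := by
    simp only [p, freeMeixnerPoly, hP1]
  have hX : polyInner μ (X * P 1) (P 0) = v := by
    have e : X * P 0 = P 1 + C (m : 𝕜) * P 0 := by
      rw [hP1, hP0]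
      ring
    rw [polyInner_X_mul, e, polyInner_add_right hμ, hv, polyInner_C_mul_right, ho 1 0 (by omega)]
    simp
  have hpe : p 2 = X * P 1 - C (α : 𝕜) * P 1 - C (v : 𝕜) * P 0 := by
    rw [hp2, hP0]
    ring
  have horth : ∀ j, j ≤ 1 → polyInner μ (p 2) (P j) = 0 := by
    intro j hj
    rw [hpe, polyInner_sub_left hμ, polyInner_sub_left hμ, polyInner_C_mul_left,
      polyInner_C_mul_left]
    interval_cases j
    · rw [hX, ho 1 0 (by omega), hP0, polyInner_one_one]
      simp
    · rw [hα, hv, ho 0 1 (by omega)]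
      simp
  -- For v = 0 the new quadratic is a multiple of P_1; otherwise orthogonality to P_0 and P_1 makes
  -- it equal to P_2.
  have hae : ∀ᵐ x : ℝ ∂μ, (p 2).eval (x : 𝕜) = 0 := by
    by_cases hv' : v = 0
    · have := ae_eval_eq_zero_of_polyInner_self_eq_zero hμ (p := P 1) (by simpa [hv'] using hv)
      filter_upwards [this] with x hx
      simp [hp2, hx, hv']
    · have hae2 := ae_eval_eq_zero_of_polyInner_self_eq_zero hμ h2
      have : p 2 - P 2 = 0 := by
        refine eq_zero_of_polyInner_eq_zero hμ hP hd ho (k := 1) ?_ ?_ fun j hj => ?_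
        · intro j hj
          interval_cases j
          · simp [hP0, polyInner_one_one]
          · simpa [hv] using hv'
        · have hm2 : (p 2).Monic := by
            rw [hp2, hP1]
            monicity!
          have hd2 : (p 2).natDegree = 2 := by
            rw [hp2, hP1]
            compute_degree!
          have hlt : (p 2 - P 2).degree < (p 2).degree := by
            refine degree_sub_lt_left ?_ hm2.ne_zero
              (by rw [hm2.leadingCoeff, (hP 2).leadingCoeff])
            rw [degree_eq_natDegree hm2.ne_zero, degree_eq_natDegree (hP 2).ne_zero, hd2, hd]
          rw [degree_eq_natDegree hm2.ne_zero, hd2] at hlt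
          exact natDegree_le_iff_degree_le.2 (Order.lt_succ_iff.1 (by exact_mod_cast hlt))
        · rw [polyInner_sub_left hμ, horth j hj, ho 2 j (by omega), sub_zero]
      rwa [sub_eq_zero.1 this]
  have hae' : ∀ n, ∀ᵐ x : ℝ ∂μ, (p (n + 2)).eval (x : 𝕜) = 0 := by
    intro n
    induction n with
    | zero => exact hae
    | succ n ih =>
      filter_upwards [ih] with x hx
      have : p (n + 3) = (X - C (α : 𝕜)) * p (n + 2) := by simp [p, freeMeixnerPoly]
      rw [this, eval_mul, hx, mul_zero]
  have hlt : ∀ m n, m < n → polyInner μ (p m) (p n) = 0 := by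
    intro m n hmn
    match n with
    | 1 =>
      obtain rfl : m = 0 := by omega
      have := ho 0 1 (by omega)
      rwa [hP0, hP1] at this
    | n + 2 =>
      rw [polyInner, integral_eq_zero_of_ae]
      filter_upwards [hae' n] with x hx
      simp [hx]
  refine isFreeMeixner_of_polyInner (𝕜 := 𝕜) (α₀ := m) (α := α) hv0 le_rfl (fun _ => rfl) ?_
  intro i j hij
  rcases lt_or_gt_of_ne hij with h | h
  · exact hlt i j h
  · rw [← polyInner_conj_symm, hlt j i h, map_zero]

/-- The convolution recurrence up to terms of lower degree. -/
theorem convolution_recurrence_lower_terms {R : Type*} [CommRing R] {P : ℕ → R[X]}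
    (hd : ∀ n, (P n).natDegree = n) {r γ : ℕ → R} (hr : r 0 = 1)
    (hrec : ∀ n, P (n + 1) = X * ∑ j ∈ Finset.range (n + 1), C (r j) * P (n - j) + C (γ n))
    (k : ℕ) : (P (k + 3) - X * P (k + 2) - C (r 1) * (X * P (k + 1)) -
      C (r 2) * (X * P k)).natDegree ≤ k := by
  have e : P (k + 3) - X * P (k + 2) - C (r 1) * (X * P (k + 1)) - C (r 2) * (X * P k) =
      X * ∑ j ∈ Finset.range k, C (r (j + 3)) * P (k - (j + 1)) + C (γ (k + 2)) := by
    rw [hrec (k + 2), Finset.sum_range_succ', Finset.sum_range_succ', Finset.sum_range_succ']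
    have : ∀ j, k + 2 - (j + 1 + 1 + 1) = k - (j + 1) := fun j => by omega
    simp only [this, hr]
    simp
    ring
  rw [e]
  refine natDegree_add_le_of_degree_le ?_ (by simp)
  rcases Nat.eq_zero_or_pos k with rfl | hk
  · simp
  have hs : (∑ j ∈ Finset.range k, C (r (j + 3)) * P (k - (j + 1))).natDegree ≤ k - 1 := by
    refine natDegree_sum_le_of_forall_le _ _ fun j _ => ?_
    refine (natDegree_C_mul_le _ _).trans ?_
    rw [hd]
    omega
  refine natDegree_mul_le.trans ?_
  have := natDegree_X_le (R := R)
  omega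

/-- Each three-term relation produces the next one as long as the norms up to the current index are
nonzero, and each relation in turn gives ‖P_{n+1}‖² = w_n‖P_n‖², which keeps the norms nonzero. -/
theorem isFreeMeixner_of_convolution_recurrence
    (hμ : ∀ n : ℕ, Integrable (fun x : ℝ => x ^ n) μ)
    (hP : ∀ n, (P n).Monic) (hd : ∀ n, (P n).natDegree = n)
    (ho : ∀ m n, m ≠ n → polyInner μ (P m) (P n) = 0) {r γ : ℕ → 𝕜} (hr : r 0 = 1)
    (hrec : ∀ n, P (n + 1) = X * ∑ j ∈ Finset.range (n + 1), C (r j) * P (n - j) + C (γ n)) :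
    IsFreeMeixner μ := by
  by_cases hh2 : polyInner μ (P 2) (P 2) = 0
  · exact isFreeMeixner_of_polyInner_two_eq_zero hμ hP hd ho hh2
  have hP0 : P 0 = 1 := (Monic.natDegree_eq_zero (hP 0)).1 (hd 0)
  have hP1 := orthogonal_one_eq hμ hP hd ho
  set m : ℝ := ∫ x, x ∂μ
  -- These values are read off by eliminating xP_{k+1} and xP_k from the convolution recurrence; ω₁
  -- is special because γ enters the relation for xP_1.
  set α : 𝕜 := -r 1
  set ω : 𝕜 := r 1 ^ 2 - r 2
  set ω₁ : 𝕜 := r 1 * γ 0 - γ 1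
  have e1 : X * P 1 = P 2 + C α * P 1 + C ω₁ * P 0 := by
    have h1 : P 1 = X + C (γ 0) := by
      have := hrec 0
      simpa [hr, hP0] using this
    have h2 : P 2 = X * (P 1 + C (r 1)) + C (γ 1) := by
      have := hrec 1
      simpa [hr, hP0, Finset.sum_range_succ] using this
    rw [h2, hP0, h1]
    simp only [α, ω₁, C_neg, C_sub, C_mul]
    ring
  have hdeg : ∀ n, (X * P n - P (n + 1)).degree < ((n + 1 : ℕ) : WithBot ℕ) := by
    intro n
    have hm : (X * P n).Monic := monic_X.mul (hP n)
    have hn : (X * P n).degree = ((n + 1 : ℕ) : WithBot ℕ) := by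
      rw [degree_eq_natDegree hm.ne_zero, natDegree_X_mul (hP n).ne_zero, hd]
    rw [← hn]
    refine degree_sub_lt_left ?_ hm.ne_zero (by rw [hm.leadingCoeff, (hP _).leadingCoeff])
    rw [hn, degree_eq_natDegree (hP _).ne_zero, hd]
  have hX : ∀ n, polyInner μ (X * P (n + 1)) (P n) = polyInner μ (P (n + 1)) (P (n + 1)) := by
    intro n
    have := polyInner_eq_zero_of_degree_lt hμ hP hd ho (n + 1) (n + 1) le_rfl _ (hdeg n)
    rw [polyInner_sub_left hμ, sub_eq_zero] at this
    rw [polyInner_X_mul, ← polyInner_conj_symm, this, polyInner_conj_symm]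
  let w : ℕ → 𝕜 := fun n => if n = 0 then ω₁ else ω
  let T : ℕ → Prop := fun n => X * P (n + 1) = P (n + 2) + C α * P (n + 1) + C (w n) * P n
  have hT0 : T 0 := e1
  have hnorm : ∀ n, T n →
      polyInner μ (P (n + 1)) (P (n + 1)) = w n * polyInner μ (P n) (P n) := by
    intro n hn
    rw [← hX, hn, polyInner_add_left hμ, polyInner_add_left hμ, polyInner_C_mul_left,
      polyInner_C_mul_left, ho (n + 2) n (by omega), ho (n + 1) n (by omega)]
    simp
  have hstep : ∀ k, T k → (∀ j, j ≤ k → polyInner μ (P j) (P j) ≠ 0) → T (k + 1) := by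
    intro k hk hh
    have hlow := convolution_recurrence_lower_terms hd hr hrec k
    set L := P (k + 3) - X * P (k + 2) - C (r 1) * (X * P (k + 1)) - C (r 2) * (X * P k) with hL
    -- The relation T k cancels everything above degree k: L, P_k and xP_k - P_{k+1} all have degree
    -- ≤ k.
    have hD : X * P (k + 2) - P (k + 3) - C α * P (k + 2) - C ω * P (k + 1) =
        -(L + C (r 1) * C (w k) * P k + C (r 2) * (X * P k - P (k + 1))) := by
      have hk' : X * P (k + 1) = P (k + 2) + C α * P (k + 1) + C (w k) * P k := hk
      rw [hL, hk']
      simp only [α, ω, C_neg, C_sub, C_pow]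
      ring
    have hz : X * P (k + 2) - P (k + 3) - C α * P (k + 2) - C ω * P (k + 1) = 0 := by
      refine eq_zero_of_polyInner_eq_zero hμ hP hd ho hh ?_ fun j hj => ?_
      · rw [hD, natDegree_neg]
        refine natDegree_add_le_of_degree_le (natDegree_add_le_of_degree_le hlow ?_) ?_
        · rw [← C_mul]
          exact (natDegree_C_mul_le _ _).trans (hd k).le
        · refine (natDegree_C_mul_le _ _).trans (natDegree_le_iff_degree_le.2 ?_)
          exact Order.lt_succ_iff.1 (by exact_mod_cast hdeg k)
      · have hlt : (X * P j).degree < ((k + 2 : ℕ) : WithBot ℕ) := by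
          rw [degree_eq_natDegree (monic_X.mul (hP j)).ne_zero, natDegree_X_mul (hP j).ne_zero, hd]
          exact_mod_cast (by omega : j + 1 < k + 2)
        have h1 : polyInner μ (X * P (k + 2)) (P j) = 0 := by
          rw [polyInner_X_mul, ← polyInner_conj_symm,
            polyInner_eq_zero_of_degree_lt hμ hP hd ho _ _ le_rfl _ hlt, map_zero]
        rw [polyInner_sub_left hμ, polyInner_sub_left hμ, polyInner_sub_left hμ,
          polyInner_C_mul_left, polyInner_C_mul_left, h1, ho (k + 3) j (by omega),
          ho (k + 2) j (by omega), ho (k + 1) j (by omega)]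
        simp
    change X * P (k + 2) = P (k + 3) + C α * P (k + 2) + C ω * P (k + 1)
    linear_combination hz
  have hh0 : polyInner μ (P 0) (P 0) = 1 := by rw [hP0, polyInner_one_one]
  -- This needs only ‖P_0‖ = 1, so ‖P_2‖² = ωω₁ holds before either factor is known to be nonzero;
  -- ‖P_2‖ ≠ 0 then gives both.
  have hT1 : T 1 := hstep 0 hT0 fun j hj => by
    obtain rfl : j = 0 := by omega
    simp [hh0]
  have hh1 : polyInner μ (P 1) (P 1) = ω₁ := by simpa [hh0, w] using hnorm 0 hT0
  have hh2' : polyInner μ (P 2) (P 2) = ω * ω₁ := by simpa [hh1, w] using hnorm 1 hT1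
  rw [hh2', mul_eq_zero, not_or] at hh2
  have hw : ∀ n, w n ≠ 0 := fun n => by
    dsimp only [w]
    split_ifs
    exacts [hh2.2, hh2.1]
  have hall : ∀ n, T n ∧ ∀ j, j ≤ n → polyInner μ (P j) (P j) ≠ 0 := by
    intro n
    induction n with
    | zero =>
      refine ⟨hT0, fun j hj => ?_⟩
      obtain rfl : j = 0 := by omega
      simp [hh0]
    | succ n ih =>
      refine ⟨hstep n ih.1 ih.2, fun j hj => ?_⟩
      rcases Nat.lt_or_ge j (n + 1) with h | h
      · exact ih.2 j (by omega)
      · obtain rfl : j = n + 1 := by omega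
        rw [hnorm n ih.1]
        exact mul_ne_zero (hw n) (ih.2 n le_rfl)
  -- The parameters so far lie in 𝕜. They are real as quotients of ⟨xP_1, P_1⟩ and ‖P_2‖² by ‖P_1‖².
  obtain ⟨v, hv0, hv⟩ := exists_polyInner_self_eq_ofReal (μ := μ) (P 1)
  obtain ⟨t, ht0, ht⟩ := exists_polyInner_self_eq_ofReal (μ := μ) (P 2)
  obtain ⟨s, hs⟩ := RCLike.conj_eq_iff_real.1
    ((polyInner_conj_symm (μ := μ) (X * P 1) (P 1)).trans (polyInner_X_mul _ _).symm)
  rw [hh1] at hv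
  have hv' : (v : 𝕜) ≠ 0 := hv ▸ hh2.2
  have hα : α = ((s / v : ℝ) : 𝕜) := by
    rw [e1, polyInner_add_left hμ, polyInner_add_left hμ, polyInner_C_mul_left,
      polyInner_C_mul_left, ho 2 1 (by omega), ho 0 1 (by omega), hh1, hv] at hs
    rw [RCLike.ofReal_div, eq_div_iff hv']
    linear_combination hs
  have hω : ω = ((t / v : ℝ) : 𝕜) := by
    rw [RCLike.ofReal_div, eq_div_iff hv', ← ht, hh2', hv]
  have hPe : ∀ n, P n = freeMeixnerPoly (m : 𝕜) ((s / v : ℝ) : 𝕜) (v : 𝕜) ((t / v : ℝ) : 𝕜) n := by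
    rw [← hα, ← hω, ← hv]
    exact eq_freeMeixnerPoly hP0 hP1 e1 fun n => (hall (n + 1)).1
  refine isFreeMeixner_of_polyInner (𝕜 := 𝕜) (α₀ := m) (α := s / v) hv0 (div_nonneg ht0 hv0)
    (fun h => absurd (by simp [h]) hv') fun i j hij => ?_
  rw [← hPe, ← hPe]
  exact ho i j hij

end Forward

theorem isFreeMeixner_of_multiplicativeRenormalizationApplies {𝕜 : Type*} [RCLike 𝕜]
    {μ : Measure ℝ} [IsProbabilityMeasure μ]
    (hμ : ∀ n : ℕ, Integrable (fun x : ℝ => x ^ n) μ)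
    (h : MultiplicativeRenormalizationApplies μ (fun t : 𝕜 => (1 - t)⁻¹)) : IsFreeMeixner μ := by
  obtain ⟨ρ, hρ, hρ0, hρ', -, -, Q, hQ, ho⟩ := h
  obtain ⟨r, hr, hrec⟩ := exists_convolution_recurrence hρ hρ0 hQ.hasSum
  rw [← hr] at hρ'
  have hd : ∀ n, (Q n).natDegree = n := fun n => natDegree_eq_of_degree_eq_some (hQ.degree_eq n)
  have hne : ∀ n, Q n ≠ 0 := fun n h0 => by
    have := hQ.degree_eq n
    simp [h0] at this
  obtain ⟨κ, hκ⟩ : ∃ κ, κ = (Q 0).coeff 0 := ⟨_, rfl⟩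
  -- Only the summand j = 0 reaches the top degree, so each step multiplies the leading coefficient
  -- by r_0 = ρ'(0).
  have hlc : ∀ n, (Q n).coeff n = κ * r 0 ^ n := by
    intro n
    induction n with
    | zero => simp [hκ]
    | succ n ih =>
      rw [hrec n, coeff_add, coeff_X_mul, coeff_C_succ, finsetSum_coeff, Finset.sum_range_succ',
        Finset.sum_eq_zero]
      · simp [ih]
        ring
      · intro j hj
        rw [Finset.mem_range] at hj
        rw [coeff_C_mul, coeff_eq_zero_of_natDegree_lt (by rw [hd]; omega), mul_zero]
  have hlc' : ∀ n, κ * r 0 ^ n = (Q n).leadingCoeff := fun n => by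
    rw [leadingCoeff, hd, hlc]
  have hκ0 : κ ≠ 0 := by
    have := hlc' 0
    simp only [pow_zero, mul_one] at this
    rw [this]
    exact leadingCoeff_ne_zero.2 (hne 0)
  -- Making Q_n monic amounts to dividing by κ and replacing z by z/r_0, hence r_j becomes r_j /
  -- r_0^{j+1}.
  refine isFreeMeixner_of_convolution_recurrence (𝕜 := 𝕜)
    (P := fun n => C (κ * r 0 ^ n)⁻¹ * Q n) (r := fun j => r j * (r 0 ^ (j + 1))⁻¹)
    (γ := fun n => (κ * r 0 ^ (n + 1))⁻¹ * (Q (n + 1)).eval 0) hμ (fun n => ?_) (fun n => ?_)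
    (fun m n hmn => ?_) (by simp [hρ']) (fun n => ?_)
  · rw [hlc' n, mul_comm]
    exact monic_mul_leadingCoeff_inv (hne n)
  · rw [natDegree_C_mul (inv_ne_zero (mul_ne_zero hκ0 (pow_ne_zero _ hρ'))), hd]
  · rw [polyInner_C_mul_left, polyInner_C_mul_right, polyInner, ho m n hmn, mul_zero, mul_zero]
  · conv_lhs => rw [hrec n]
    rw [mul_add, ← C_mul]
    congr 1
    rw [mul_left_comm, Finset.mul_sum]
    congr 1
    refine Finset.sum_congr rfl fun j hj => ?_
    rw [← mul_assoc, ← mul_assoc, ← C_mul, ← C_mul]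
    congr 2
    have : n + 1 = (j + 1) + (n - j) := by
      rw [Finset.mem_range] at hj
      omega
    rw [this, pow_add]
    field_simp

/-! ### Growth, rational generating functions and series of integrable functions. -/

/-- Sequences satisfying a linear recurrence inequality grow at most exponentially. -/
theorem exists_le_mul_pow_of_recurrence {u : ℕ → ℝ} {A B D L : ℝ} (hA : 0 ≤ A) (hB : 0 ≤ B)
    (hD : 0 ≤ D) (hL : 0 ≤ L)
    (hu : ∀ n, u (n + 3) ≤ A * u (n + 2) + B * u (n + 1) + D * L ^ n) :
    ∃ M K : ℝ, 0 ≤ M ∧ 1 ≤ K ∧ ∀ n, u n ≤ M * K ^ n := by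
  -- M dominates the three initial values, and M ≥ 1 lets M Kⁿ absorb Lⁿ; K dominates both L and A +
  -- B + D.
  set M := |u 0| + |u 1| + |u 2| + 1 with hM
  set K := A + B + D + L + 1 with hK
  have hM1 : 1 ≤ M := by
    have := abs_nonneg (u 0)
    have := abs_nonneg (u 1)
    have := abs_nonneg (u 2)
    linarith
  have hK1 : 1 ≤ K := by linarith
  have hsmall : ∀ n, |u n| ≤ M → u n ≤ M * K ^ n := fun n hn =>
    ((le_abs_self _).trans hn).trans (le_mul_of_one_le_right (by linarith) (one_le_pow₀ hK1))
  have a0 := abs_nonneg (u 0)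
  have a1 := abs_nonneg (u 1)
  have a2 := abs_nonneg (u 2)
  refine ⟨M, K, by linarith, hK1, fun n => ?_⟩
  induction n using Nat.strong_induction_on with
  | _ n ih =>
    match n with
    | 0 => exact hsmall 0 (by linarith)
    | 1 => exact hsmall 1 (by linarith)
    | 2 => exact hsmall 2 (by linarith)
    | n + 3 =>
      have i1 := ih (n + 1) (by omega)
      have i2 := ih (n + 2) (by omega)
      have hp : 0 ≤ M * K ^ (n + 2) := by positivity
      have e1 : M * K ^ (n + 1) ≤ M * K ^ (n + 2) :=
        mul_le_mul_of_nonneg_left (pow_le_pow_right₀ hK1 (by omega)) (by linarith)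
      have e2 : L ^ n ≤ M * K ^ (n + 2) := by
        calc L ^ n ≤ K ^ n := by gcongr; linarith
          _ ≤ K ^ (n + 2) := pow_le_pow_right₀ hK1 (by omega)
          _ ≤ M * K ^ (n + 2) := le_mul_of_one_le_left (by positivity) hM1
      calc u (n + 3) ≤ A * u (n + 2) + B * u (n + 1) + D * L ^ n := hu n
        _ ≤ A * (M * K ^ (n + 2)) + B * (M * K ^ (n + 2)) + D * (M * K ^ (n + 2)) := by
          gcongr
          exact i1.trans e1
        _ = (A + B + D) * (M * K ^ (n + 2)) := by ring
        _ ≤ K * (M * K ^ (n + 2)) := by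
          gcongr
          linarith
        _ = M * K ^ (n + 3) := by ring

theorem summable_norm_mul_pow_of_le {𝕜 : Type*} [RCLike 𝕜] {u : ℕ → 𝕜} {M K : ℝ} (hK : 0 ≤ K)
    (hu : ∀ n, ‖u n‖ ≤ M * K ^ n) {z : 𝕜} (hz : K * ‖z‖ < 1) : Summable fun n => ‖u n * z ^ n‖ := by
  refine Summable.of_nonneg_of_le (fun _ => norm_nonneg _) (fun n => ?_)
    ((summable_geometric_of_lt_one (by positivity) hz).mul_left M)
  rw [norm_mul, norm_pow, mul_pow, ← mul_assoc]
  gcongr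
  exact hu n

theorem eventually_mul_norm_lt_one {𝕜 : Type*} [RCLike 𝕜] (K : ℝ) :
    ∀ᶠ z in 𝓝 (0 : 𝕜), K * ‖z‖ < 1 := by
  have h : ContinuousAt (fun z : 𝕜 => K * ‖z‖) 0 := by fun_prop
  exact h.eventually_lt continuousAt_const (by simp)

/-- The generating function of a sequence with a second order recurrence is rational. -/
theorem mul_tsum_of_recurrence {𝕜 : Type*} [RCLike 𝕜] {u : ℕ → 𝕜} {a b z : 𝕜}
    (hu : ∀ n, u (n + 3) = a * u (n + 2) + b * u (n + 1)) (hs : Summable fun n => u n * z ^ n) :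
    (1 - a * z - b * z ^ 2) * ∑' n, u n * z ^ n =
      u 0 + (u 1 - a * u 0) * z + (u 2 - a * u 1 - b * u 0) * z ^ 2 := by
  have h3 := hs.sum_add_tsum_nat_add 3
  have h2 := hs.sum_add_tsum_nat_add 2
  have h1 := hs.sum_add_tsum_nat_add 1
  have s2 := (summable_nat_add_iff 2).2 hs
  have s1 := (summable_nat_add_iff 1).2 hs
  have e : ∑' n, u (n + 3) * z ^ (n + 3) =
      a * z * ∑' n, u (n + 2) * z ^ (n + 2) + b * z ^ 2 * ∑' n, u (n + 1) * z ^ (n + 1) := by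
    rw [← tsum_mul_left, ← tsum_mul_left, ← (s2.mul_left _).tsum_add (s1.mul_left _)]
    refine tsum_congr fun n => ?_
    rw [hu]
    ring
  simp only [Finset.sum_range_succ, Finset.sum_range_zero, zero_add, pow_zero, mul_one,
    pow_one] at h1 h2 h3
  rw [e] at h3
  linear_combination (-1) * h3 + a * z * h2 + b * z ^ 2 * h1

theorem eventually_hasSum_of_recurrence {𝕜 : Type*} [RCLike 𝕜] {u : ℕ → 𝕜} {a b : 𝕜}
    (hu : ∀ n, u (n + 3) = a * u (n + 2) + b * u (n + 1)) :
    ∀ᶠ z in 𝓝 (0 : 𝕜), HasSum (fun n => u n * z ^ n)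
      ((u 0 + (u 1 - a * u 0) * z + (u 2 - a * u 1 - b * u 0) * z ^ 2) /
        (1 - a * z - b * z ^ 2)) := by
  obtain ⟨M, K, -, hK, hM⟩ := exists_le_mul_pow_of_recurrence (u := fun n => ‖u n‖)
    (norm_nonneg a) (norm_nonneg b) le_rfl le_rfl (fun n => by
      rw [zero_mul, add_zero, hu, ← norm_mul, ← norm_mul]
      exact norm_add_le _ _)
  have hc : ContinuousAt (fun z : 𝕜 => 1 - a * z - b * z ^ 2) 0 := by fun_prop
  filter_upwards [eventually_mul_norm_lt_one K, hc.eventually_ne (by simp : _ ≠ (0 : 𝕜))]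
    with z hz hz'
  have hs : Summable fun n => u n * z ^ n :=
    (summable_norm_mul_pow_of_le (by linarith) hM hz).of_norm
  rw [← mul_tsum_of_recurrence hu hs, mul_div_cancel_left₀ _ hz']
  exact hs.hasSum

/-- By Tonelli, the sum of the norms has finite integral and is therefore finite almost everywhere.
-/
theorem ae_summable_norm_of_summable_integral_norm {X E : Type*} [MeasurableSpace X]
    {μ : Measure X} [NormedAddCommGroup E] {F : ℕ → X → E}
    (hF : ∀ n, Integrable (F n) μ) (hs : Summable fun n => ∫ x, ‖F n x‖ ∂μ) :
    (∀ᵐ x ∂μ, Summable fun n => ‖F n x‖) ∧ ∫⁻ x, ∑' n, ‖F n x‖ₑ ∂μ ≠ ⊤ := by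
  have hfin : ∫⁻ x, ∑' n, ‖F n x‖ₑ ∂μ ≠ ⊤ := by
    rw [lintegral_tsum fun n => (hF n).1.enorm]
    simp_rw [← fun n => ofReal_integral_norm_eq_lintegral_enorm (hF n)]
    rw [← ENNReal.ofReal_tsum_of_nonneg (fun n => integral_nonneg fun _ => norm_nonneg _) hs]
    exact ENNReal.ofReal_ne_top
  refine ⟨?_, hfin⟩
  filter_upwards [ae_lt_top' (AEMeasurable.tsum fun n => (hF n).1.enorm) hfin] with x hx
  exact NNReal.summable_coe.2 (ENNReal.tsum_coe_ne_top_iff_summable.1 hx.ne)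

theorem integrable_tsum_of_summable_integral_norm {X E : Type*} [MeasurableSpace X]
    {μ : Measure X} [NormedAddCommGroup E] [CompleteSpace E] {F : ℕ → X → E}
    (hF : ∀ n, Integrable (F n) μ) (hs : Summable fun n => ∫ x, ‖F n x‖ ∂μ) :
    Integrable (fun x => ∑' n, F n x) μ := by
  obtain ⟨hae, hfin⟩ := ae_summable_norm_of_summable_integral_norm hF hs
  refine ⟨?_, ?_⟩
  · refine aestronglyMeasurable_of_tendsto_ae atTop
      (f := fun n x => ∑ i ∈ Finset.range n, F i x) (fun n => ?_) ?_
    · exact Finset.aestronglyMeasurable_fun_sum _ fun i _ => (hF i).1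
    · filter_upwards [hae] with x hx
      exact hx.of_norm.hasSum.tendsto_sum_nat
  · rw [hasFiniteIntegral_iff_enorm]
    refine lt_of_le_of_lt (lintegral_mono fun x => ?_) (lt_top_iff_ne_top.2 hfin)
    exact enorm_tsum_le_tsum_enorm

theorem eLpNorm_two_le {X E : Type*} [MeasurableSpace X] {μ : Measure X} [NormedAddCommGroup E]
    {f : X → E} (hf : MemLp f 2 μ) {M : ℝ} (hM : ∫ x, ‖f x‖ ^ 2 ∂μ ≤ M) :
    eLpNorm f 2 μ ≤ ENNReal.ofReal √M := by
  rw [hf.eLpNorm_eq_integral_rpow_norm (by simp) (by simp), Real.sqrt_eq_rpow]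
  refine ENNReal.ofReal_le_ofReal ?_
  have : ∫ x, ‖f x‖ ^ (2 : ENNReal).toReal ∂μ = ∫ x, ‖f x‖ ^ 2 ∂μ := by simp
  rw [this]
  simp only [ENNReal.toReal_ofNat, one_div]
  exact Real.rpow_le_rpow (integral_nonneg fun _ => by positivity) hM (by norm_num)

theorem freeMeixnerPoly_monic_natDegree {R : Type*} [CommRing R] [Nontrivial R]
    (α₀ α ω₁ ω : R) (n : ℕ) : (freeMeixnerPoly α₀ α ω₁ ω n).Monic ∧
      (freeMeixnerPoly α₀ α ω₁ ω n).natDegree = n := by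
  have key : ∀ (p q : R[X]) (c : R), p.Monic → q.natDegree < p.natDegree + 1 →
      ((X - C α) * p - C c * q).Monic ∧
        ((X - C α) * p - C c * q).natDegree = p.natDegree + 1 := by
    intro p q c hp hq
    have hm := (monic_X_sub_C α).mul hp
    have hd : ((X - C α) * p).natDegree = p.natDegree + 1 := by
      rw [(monic_X_sub_C α).natDegree_mul hp, natDegree_X_sub_C, add_comm]
    have hlt : (C c * q).natDegree < ((X - C α) * p).natDegree := by
      rw [hd]
      exact (natDegree_C_mul_le _ _).trans_lt hq
    refine ⟨hm.sub_of_left (degree_lt_degree hlt), ?_⟩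
    rw [natDegree_sub_eq_left_of_natDegree_lt hlt, hd]
  induction n using Nat.strong_induction_on with
  | _ n ih =>
    match n with
    | 0 => simp [freeMeixnerPoly]
    | 1 => exact ⟨monic_X_sub_C _, natDegree_X_sub_C _⟩
    | 2 =>
      have := key (X - C α₀) 1 ω₁ (monic_X_sub_C _) (by simp)
      simpa [freeMeixnerPoly] using this
    | n + 3 =>
      obtain ⟨h2, h2'⟩ := ih (n + 2) (by omega)
      obtain ⟨-, h1'⟩ := ih (n + 1) (by omega)
      have := key _ (freeMeixnerPoly α₀ α ω₁ ω (n + 1)) ω h2 (by omega)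
      rw [h2'] at this
      exact this

theorem eval_freeMeixnerPoly_ofReal {𝕜 : Type*} [RCLike 𝕜] (α₀ α ω₁ ω : ℝ) (n : ℕ) (x : ℝ) :
    (freeMeixnerPoly (α₀ : 𝕜) α ω₁ ω n).eval (x : 𝕜) =
      ((freeMeixnerPoly α₀ α ω₁ ω n).eval x : ℝ) := by
  simp only [← RCLike.algebraMap_eq_ofReal, ← map_freeMeixnerPoly, eval_map_apply]

theorem eval_freeMeixnerPoly_add_three {R : Type*} [CommRing R] (α₀ α ω₁ ω x : R) (n : ℕ) :
    (freeMeixnerPoly α₀ α ω₁ ω (n + 3)).eval x =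
      (x - α) * (freeMeixnerPoly α₀ α ω₁ ω (n + 2)).eval x +
        -ω * (freeMeixnerPoly α₀ α ω₁ ω (n + 1)).eval x := by
  simp [freeMeixnerPoly]
  ring

/-- Coefficient form of E · (D/(D - wx)) = D · (E/(D - wx)). It transfers L² bounds from the
orthogonal family to the coefficients of (1 - ρx)⁻¹, which are not orthogonal in general. -/
theorem freeMeixnerPoly_zero_relation {R : Type*} [CommRing R] (α₀ α ω₁ ω : R) (n : ℕ) :
    freeMeixnerPoly 0 α 0 ω (n + 2) + C (α - α₀) * freeMeixnerPoly 0 α 0 ω (n + 1) +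
        C (ω - ω₁) * freeMeixnerPoly 0 α 0 ω n =
      freeMeixnerPoly α₀ α ω₁ ω (n + 2) + C α * freeMeixnerPoly α₀ α ω₁ ω (n + 1) +
        C ω * freeMeixnerPoly α₀ α ω₁ ω n := by
  induction n using Nat.strong_induction_on with
  | _ n ih =>
    match n with
    | 0 | 1 | 2 =>
      simp [freeMeixnerPoly]
      ring
    | n + 3 =>
      have i1 := ih (n + 1) (by omega)
      have i2 := ih (n + 2) (by omega)
      have hr : ∀ α₀ ω₁ k, freeMeixnerPoly α₀ α ω₁ ω (k + 3) =
          (X - C α) * freeMeixnerPoly α₀ α ω₁ ω (k + 2) -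
            C ω * freeMeixnerPoly α₀ α ω₁ ω (k + 1) := fun _ _ _ => by rw [freeMeixnerPoly]
      have s2 := hr 0 0 (n + 2)
      have s1 := hr 0 0 (n + 1)
      have p2 := hr α₀ ω₁ (n + 2)
      have p1 := hr α₀ ω₁ (n + 1)
      simp only [add_assoc, Nat.reduceAdd] at i1 i2 s2 s1 p2 p1 ⊢
      linear_combination (X - C α) * i2 - C ω * i1 + s2 + C (α - α₀) * s1 +
        C (ω - ω₁) * hr 0 0 n - p2 - C α * p1 - C ω * hr α₀ ω₁ n

theorem integrable_eval {μ : Measure ℝ} (hμ : ∀ n : ℕ, Integrable (fun x : ℝ => x ^ n) μ)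
    (p : ℝ[X]) : Integrable (fun x => p.eval x) μ := by
  simpa using integrable_eval_ofReal (𝕜 := ℝ) hμ p

section Growth

variable {μ : Measure ℝ} {α₀ α ω₁ ω : ℝ}

/-- Pairing xP_{n+3} with P_{n+2} and moving x across gives ‖P_{n+3}‖² = ω‖P_{n+2}‖². -/
theorem exists_integral_sq_freeMeixnerPoly_le (hμ : ∀ n : ℕ, Integrable (fun x : ℝ => x ^ n) μ)
    (hω : 0 ≤ ω) (ho : ∀ m n, m ≠ n → ∫ x, (freeMeixnerPoly α₀ α ω₁ ω m).eval x *
      (freeMeixnerPoly α₀ α ω₁ ω n).eval x ∂μ = 0) :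
    ∃ M K : ℝ, 0 ≤ M ∧ 1 ≤ K ∧
      ∀ n, ∫ x, (freeMeixnerPoly α₀ α ω₁ ω n).eval x ^ 2 ∂μ ≤ M * K ^ n := by
  refine exists_le_mul_pow_of_recurrence (A := ω) (B := 0) (D := 0) (L := 0) hω le_rfl le_rfl le_rfl
    fun n => ?_
  set p := freeMeixnerPoly α₀ α ω₁ ω with hp
  have ho' : ∀ m n, m ≠ n → polyInner (𝕜 := ℝ) μ (p m) (p n) = 0 := fun m n hmn => by
    simpa [polyInner] using ho m n hmn
  have e : ∀ n, X * p (n + 2) = p (n + 3) + (C α * p (n + 2) + C ω * p (n + 1)) := fun n => by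
    simp only [p, freeMeixnerPoly]
    ring
  have h := polyInner_X_mul (μ := μ) (p (n + 3)) (p (n + 2))
  rw [e n, e (n + 1)] at h
  simp only [polyInner_add_left hμ, polyInner_add_right hμ, polyInner_C_mul_left,
    polyInner_C_mul_right] at h
  rw [ho' (n + 1 + 3) (n + 2) (by omega), ho' (n + 1 + 2) (n + 2) (by omega),
    ho' (n + 3) (n + 1) (by omega)] at h
  have h' : ω * polyInner (𝕜 := ℝ) μ (p (n + 2)) (p (n + 2)) =
      polyInner (𝕜 := ℝ) μ (p (n + 3)) (p (n + 3)) := by simpa using h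
  have hsq : ∀ n, ∫ x, (p n).eval x ^ 2 ∂μ = polyInner (𝕜 := ℝ) μ (p n) (p n) := fun n => by
    simp [polyInner, pow_two]
  rw [hsq, hsq, hsq, h']
  simp

/-- The relation between the two families, squared and integrated, is a recurrence inequality with a
geometric forcing term. -/
theorem exists_integral_sq_freeMeixnerPoly_zero_le
    (hμ : ∀ n : ℕ, Integrable (fun x : ℝ => x ^ n) μ) {M K : ℝ} (hM : 0 ≤ M) (hK : 1 ≤ K)
    (h : ∀ n, ∫ x, (freeMeixnerPoly α₀ α ω₁ ω n).eval x ^ 2 ∂μ ≤ M * K ^ n) :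
    ∃ M' K' : ℝ, 0 ≤ M' ∧ 1 ≤ K' ∧
      ∀ n, ∫ x, (freeMeixnerPoly 0 α 0 ω n).eval x ^ 2 ∂μ ≤ M' * K' ^ n := by
  set p := freeMeixnerPoly α₀ α ω₁ ω with hp
  set s := freeMeixnerPoly 0 α 0 ω with hs
  set A := α - α₀
  set B := ω - ω₁
  refine exists_le_mul_pow_of_recurrence (A := 5 * A ^ 2) (B := 5 * B ^ 2)
    (D := 5 * M * (K ^ 3 + α ^ 2 * K ^ 2 + ω ^ 2 * K)) (L := K) (by positivity) (by positivity)
    (by positivity) (by positivity) fun n => ?_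
  have i : ∀ p : ℝ[X], Integrable (fun x => p.eval x ^ 2) μ := fun p => by
    have := integrable_eval hμ (p ^ 2)
    simpa only [eval_pow] using this
  have hle : ∀ x, (s (n + 3)).eval x ^ 2 ≤ 5 * A ^ 2 * (s (n + 2)).eval x ^ 2 +
      5 * B ^ 2 * (s (n + 1)).eval x ^ 2 + 5 * (p (n + 3)).eval x ^ 2 +
      5 * α ^ 2 * (p (n + 2)).eval x ^ 2 + 5 * ω ^ 2 * (p (n + 1)).eval x ^ 2 := by
    intro x
    have h1 := congrArg (eval x) (freeMeixnerPoly_zero_relation α₀ α ω₁ ω (n + 1))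
    simp only [eval_add, eval_mul, eval_C] at h1
    have h2 : (s (n + 3)).eval x = -(A * (s (n + 2)).eval x) - B * (s (n + 1)).eval x +
        (p (n + 3)).eval x + α * (p (n + 2)).eval x + ω * (p (n + 1)).eval x := by
      linear_combination h1
    rw [h2]
    -- Cauchy–Schwarz for five terms, as a sum of the ten squares of pairwise differences of the
    -- signed terms.
    have hfive : ∀ a b c d e : ℝ, (-a - b + c + d + e) ^ 2 ≤
        5 * a ^ 2 + 5 * b ^ 2 + 5 * c ^ 2 + 5 * d ^ 2 + 5 * e ^ 2 := by
      intro a b c d e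
      nlinarith [sq_nonneg (a - b), sq_nonneg (a + c), sq_nonneg (a + d), sq_nonneg (a + e),
        sq_nonneg (b + c), sq_nonneg (b + d), sq_nonneg (b + e), sq_nonneg (c - d),
        sq_nonneg (c - e), sq_nonneg (d - e)]
    refine (hfive _ _ _ _ _).trans_eq ?_
    ring
  have i1 := (i (s (n + 2))).const_mul (5 * A ^ 2)
  have i2 := (i (s (n + 1))).const_mul (5 * B ^ 2)
  have i3 := (i (p (n + 3))).const_mul 5
  have i4 := (i (p (n + 2))).const_mul (5 * α ^ 2)
  have i5 := (i (p (n + 1))).const_mul (5 * ω ^ 2)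
  have key := integral_add' (((i1.add i2).add i3).add i4) i5
  rw [integral_add' ((i1.add i2).add i3) i4, integral_add' (i1.add i2) i3,
    integral_add' i1 i2] at key
  simp only [integral_const_mul] at key
  refine (integral_mono (i _) ((((i1.add i2).add i3).add i4).add i5) hle).trans (key.trans_le ?_)
  have h3 := h (n + 3)
  have h2 := h (n + 2)
  have h1 := h (n + 1)
  have : 5 * M * (K ^ 3 + α ^ 2 * K ^ 2 + ω ^ 2 * K) * K ^ n = 5 * (M * K ^ (n + 3)) +
    5 * α ^ 2 * (M * K ^ (n + 2)) + 5 * ω ^ 2 * (M * K ^ (n + 1)) := by ring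
  rw [this]
  have g4 := mul_le_mul_of_nonneg_left h2 (by positivity : 0 ≤ 5 * α ^ 2)
  have g5 := mul_le_mul_of_nonneg_left h1 (by positivity : 0 ≤ 5 * ω ^ 2)
  linarith

end Growth

/-- The rescaled polynomials are the coefficients of a pre-generating function as soon as the
rational generating function is the expected one. -/
theorem isPreGeneratingFunction_freeMeixnerPoly {𝕜 : Type*} [RCLike 𝕜] {μ : Measure ℝ}
    (hμ : ∀ n : ℕ, Integrable (fun x : ℝ => x ^ n) μ) {α₀ α ω₁ ω M K l : ℝ} (hM : 0 ≤ M)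
    (hK : 0 ≤ K) (h : ∀ n, ∫ x, (freeMeixnerPoly α₀ α ω₁ ω n).eval x ^ 2 ∂μ ≤ M * K ^ n)
    (hl : l ≠ 0) (hlK : l ^ 2 * K ≤ 1) {φ : 𝕜 → ℝ → 𝕜}
    (hφ : ∀ x : ℝ, ∀ᶠ w in 𝓝 (0 : 𝕜), φ w x =
      (1 + ((α : 𝕜) - α₀) * w + ((ω : 𝕜) - ω₁) * w ^ 2) / (1 + (α - x) * w + ω * w ^ 2)) :
    IsPreGeneratingFunction μ (fun z x => φ (l * z) x)
      (fun n => C ((l : 𝕜) ^ n) * freeMeixnerPoly (α₀ : 𝕜) α ω₁ ω n) := by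
  have hl' : (l : 𝕜) ≠ 0 := by simpa using hl
  refine ⟨fun n => ?_, ?_, fun x => ?_⟩
  · obtain ⟨h1, h2⟩ := freeMeixnerPoly_monic_natDegree (α₀ : 𝕜) α ω₁ ω n
    rw [degree_C_mul (pow_ne_zero _ hl'), degree_eq_natDegree h1.ne_zero, h2]
  · refine lt_of_le_of_lt (limsup_le_of_le (by isBoundedDefault)
      (Eventually.of_forall fun n => ?_)) (ENNReal.ofReal_lt_top (r := √M))
    have e : ∀ x : ℝ, ‖(C ((l : 𝕜) ^ n) * freeMeixnerPoly (α₀ : 𝕜) α ω₁ ω n).eval (x : 𝕜)‖ ^ 2 =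
        (l ^ 2) ^ n * (freeMeixnerPoly α₀ α ω₁ ω n).eval x ^ 2 := by
      intro x
      rw [eval_mul, eval_C, eval_freeMeixnerPoly_ofReal, norm_mul, norm_pow, RCLike.norm_ofReal,
        RCLike.norm_ofReal, mul_pow, sq_abs, ← pow_mul, mul_comm n 2, pow_mul, sq_abs]
    refine eLpNorm_two_le ?_ ?_
    · rw [memLp_two_iff_integrable_sq_norm (integrable_eval_ofReal hμ _).1]
      simp only [e]
      have := integrable_eval hμ (freeMeixnerPoly α₀ α ω₁ ω n ^ 2)
      simp only [eval_pow] at this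
      exact this.const_mul _
    · simp only [e]
      rw [integral_const_mul]
      calc (l ^ 2) ^ n * ∫ x, (freeMeixnerPoly α₀ α ω₁ ω n).eval x ^ 2 ∂μ
          ≤ (l ^ 2) ^ n * (M * K ^ n) := by
            gcongr
            exact h n
        _ = M * (l ^ 2 * K) ^ n := by ring
        _ ≤ M * 1 := by
            gcongr
            exact pow_le_one₀ (by positivity) hlK
        _ = M := mul_one M
  · have hs := eventually_hasSum_of_recurrence
      (u := fun n => (freeMeixnerPoly (α₀ : 𝕜) α ω₁ ω n).eval (x : 𝕜))
      (fun n => eval_freeMeixnerPoly_add_three _ _ _ _ _ n)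
    have ht : Tendsto (fun z : 𝕜 => (l : 𝕜) * z) (𝓝 0) (𝓝 0) := by
      have : Continuous fun z : 𝕜 => (l : 𝕜) * z := by fun_prop
      simpa using this.tendsto 0
    filter_upwards [ht.eventually hs, ht.eventually (hφ x)] with z h1 h2
    rw [h2]
    convert h1 using 1
    · funext n
      rw [eval_mul, eval_C, mul_pow]
      ring
    · congr 1
      · simp only [freeMeixnerPoly, eval_one, eval_sub, eval_mul, eval_X, eval_C]
        ring
      · ring

/-- The support of μ is not known to be bounded, so no neighborhood of 0 in w serves all x through
the pointwise expansion. For fixed small w, the geometric bounds on the L¹ norms give convergence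
almost everywhere and termwise integration, in which only n = 0 survives. -/
theorem eventually_integral_inv_one_sub {𝕜 : Type*} [RCLike 𝕜] {μ : Measure ℝ}
    [IsProbabilityMeasure μ] (hμ : ∀ n : ℕ, Integrable (fun x : ℝ => x ^ n) μ)
    {α₀ α ω₁ ω M K : ℝ} (hK : 1 ≤ K)
    (h : ∀ n, ∫ x, (freeMeixnerPoly α₀ α ω₁ ω n).eval x ^ 2 ∂μ ≤ M * K ^ n)
    (ho : ∀ m n, m ≠ n → ∫ x, (freeMeixnerPoly α₀ α ω₁ ω m).eval x *
      (freeMeixnerPoly α₀ α ω₁ ω n).eval x ∂μ = 0) :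
    ∀ᶠ w in 𝓝 (0 : 𝕜),
      Integrable (fun x : ℝ => (1 - w / (1 + α * w + ω * w ^ 2) * (x : 𝕜))⁻¹) μ ∧
      ∫ x : ℝ, (1 - w / (1 + α * w + ω * w ^ 2) * (x : 𝕜))⁻¹ ∂μ =
        (1 + α * w + ω * w ^ 2) / (1 + (α - α₀) * w + (ω - ω₁) * w ^ 2) := by
  have hd : ContinuousAt (fun w : 𝕜 => 1 + α * w + ω * w ^ 2) 0 := by fun_prop
  have he : ContinuousAt (fun w : 𝕜 => 1 + (α - α₀) * w + (ω - ω₁) * w ^ 2) 0 := by fun_prop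
  filter_upwards [hd.eventually_ne (by simp : _ ≠ (0 : 𝕜)),
    he.eventually_ne (by simp : _ ≠ (0 : 𝕜)), eventually_mul_norm_lt_one K] with w hdw hew hw
  set d : 𝕜 := 1 + α * w + ω * w ^ 2 with hd'
  set e : 𝕜 := 1 + (α - α₀) * w + (ω - ω₁) * w ^ 2 with he'
  set p := freeMeixnerPoly (α₀ : 𝕜) α ω₁ ω with hp
  set F : ℕ → ℝ → 𝕜 := fun n x => (p n).eval (x : 𝕜) * w ^ n with hF
  have hpe : ∀ n (x : ℝ), (p n).eval (x : 𝕜) = ((freeMeixnerPoly α₀ α ω₁ ω n).eval x : ℝ) :=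
    fun n x => eval_freeMeixnerPoly_ofReal _ _ _ _ _ _
  have hFi : ∀ n, Integrable (F n) μ := fun n => (integrable_eval_ofReal hμ (p n)).mul_const _
  -- From |t| ≤ 1 + t², total mass 1 and 1 ≤ Kⁿ.
  have habs : ∀ n, ∫ x : ℝ, ‖(p n).eval (x : 𝕜)‖ ∂μ ≤ (1 + M) * K ^ n := by
    intro n
    have i2 : Integrable (fun x => (freeMeixnerPoly α₀ α ω₁ ω n).eval x ^ 2) μ := by
      have := integrable_eval hμ (freeMeixnerPoly α₀ α ω₁ ω n ^ 2)
      simpa only [eval_pow] using this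
    calc ∫ x : ℝ, ‖(p n).eval (x : 𝕜)‖ ∂μ
        ≤ ∫ x, (1 + (freeMeixnerPoly α₀ α ω₁ ω n).eval x ^ 2) ∂μ := by
          refine integral_mono (integrable_eval_ofReal hμ (p n)).norm
            ((integrable_const 1).add i2) fun x => ?_
          simp only [hpe, RCLike.norm_ofReal]
          nlinarith [sq_nonneg (|(freeMeixnerPoly α₀ α ω₁ ω n).eval x| - 1),
            sq_abs ((freeMeixnerPoly α₀ α ω₁ ω n).eval x)]
      _ = 1 + ∫ x, (freeMeixnerPoly α₀ α ω₁ ω n).eval x ^ 2 ∂μ := by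
          rw [integral_add (integrable_const 1) i2]
          simp
      _ ≤ K ^ n + M * K ^ n := add_le_add (one_le_pow₀ hK) (h n)
      _ = (1 + M) * K ^ n := by ring
  have hFs : Summable fun n => ∫ x, ‖F n x‖ ∂μ := by
    refine Summable.of_nonneg_of_le (fun _ => integral_nonneg fun _ => norm_nonneg _) (fun n => ?_)
      ((summable_geometric_of_lt_one (by positivity) hw).mul_left (1 + M))
    simp only [hF, norm_mul, norm_pow]
    rw [integral_mul_const, mul_pow, ← mul_assoc]
    gcongr
    exact habs n
  have hint : ∫ x, ∑' n, F n x ∂μ = 1 := by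
    refine (hasSum_integral_of_summable_integral_norm hFi hFs).unique ?_
    have h0 : ∀ n, n ≠ 0 → ∫ x, F n x ∂μ = 0 := by
      intro n hn
      have := ho n 0 hn
      simp only [freeMeixnerPoly, eval_one, mul_one] at this
      simp only [hF, hpe]
      rw [integral_mul_const, integral_ofReal, this]
      simp
    have h1 : ∫ x, F 0 x ∂μ = 1 := by simp [hF, hp, freeMeixnerPoly]
    rw [← h1]
    exact hasSum_single 0 h0
  have hae : ∀ᵐ x : ℝ ∂μ, d / e * ∑' n, F n x = (1 - w / d * (x : 𝕜))⁻¹ := by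
    filter_upwards [(ae_summable_norm_of_summable_integral_norm hFi hFs).1] with x hx
    have hm := mul_tsum_of_recurrence (u := fun n => (p n).eval (x : 𝕜)) (a := x - α) (b := -ω)
      (z := w) (fun n => eval_freeMeixnerPoly_add_three _ _ _ _ _ n) hx.of_norm
    have hm' : (d - w * x) * ∑' n, F n x = e := by
      have e1 : d - w * x = 1 - (x - α) * w - -(ω : 𝕜) * w ^ 2 := by
        rw [hd']
        ring
      rw [e1, hm]
      simp only [hp, freeMeixnerPoly, eval_one, eval_sub, eval_mul, eval_X, eval_C, he']
      ring
    -- A pole at x is excluded by the convergence of the series there: its product with d - wx is e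
    -- ≠ 0.
    have hne : d - w * x ≠ 0 := fun h0 => hew (by rw [← hm', h0, zero_mul])
    refine eq_inv_of_mul_eq_one_left ?_
    have e2 : 1 - w / d * (x : 𝕜) = (d - w * x) / d := by field_simp
    rw [e2]
    field_simp
    rw [mul_comm]
    exact hm'
  refine ⟨((integrable_tsum_of_summable_integral_norm hFi hFs).const_mul (d / e)).congr hae, ?_⟩
  rw [← integral_congr_ae hae, integral_const_mul, hint, mul_one]

theorem multiplicativeRenormalizationApplies_of_isFreeMeixner {𝕜 : Type*} [RCLike 𝕜]
    {μ : Measure ℝ} [IsProbabilityMeasure μ]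
    (hμ : ∀ n : ℕ, Integrable (fun x : ℝ => x ^ n) μ) (h : IsFreeMeixner μ) :
    MultiplicativeRenormalizationApplies μ (fun t : 𝕜 => (1 - t)⁻¹) := by
  obtain ⟨α₀, α, ω₁, ω, -, hω, -, ho⟩ := exists_freeMeixnerPoly_of_isFreeMeixner h
  obtain ⟨M, K, hM, hK, hP⟩ := exists_integral_sq_freeMeixnerPoly_le hμ hω ho
  obtain ⟨M', K', hM', hK', hS⟩ := exists_integral_sq_freeMeixnerPoly_zero_le hμ hM hK hP
  have hint := eventually_integral_inv_one_sub (𝕜 := 𝕜) hμ hK hP ho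
  set r : 𝕜 → 𝕜 := fun w => w / (1 + α * w + ω * w ^ 2) with hr
  -- One scale for both families: l ≤ 1 and l(K + K') = 1 give l²K ≤ 1 and l²K' ≤ 1.
  set l : ℝ := (K + K')⁻¹ with hl
  have hl0 : 0 < l := by positivity
  have hlK : l * (K + K') = 1 := inv_mul_cancel₀ (by positivity)
  have hl1 : l ≤ 1 := inv_le_one_of_one_le₀ (by linarith)
  have hl' : (l : 𝕜) ≠ 0 := by simpa using hl0.ne'
  have hlc : Continuous fun z : 𝕜 => (l : 𝕜) * z := by fun_prop
  have ht : Tendsto (fun z : 𝕜 => (l : 𝕜) * z) (𝓝 0) (𝓝 0) := by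
    simpa using hlc.tendsto 0
  have hd : ContinuousAt (fun w : 𝕜 => 1 + α * w + ω * w ^ 2) 0 := by fun_prop
  have hd0 : ∀ᶠ w in 𝓝 (0 : 𝕜), 1 + (α : 𝕜) * w + ω * w ^ 2 ≠ 0 :=
    hd.eventually_ne (by simp : _ ≠ (0 : 𝕜))
  have hinv : ∀ x : ℝ, ∀ᶠ w in 𝓝 (0 : 𝕜), (1 - r w * (x : 𝕜))⁻¹ =
      (1 + α * w + ω * w ^ 2) / (1 + (α - x) * w + ω * w ^ 2) := by
    intro x
    filter_upwards [hd0] with w hw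
    have e : 1 - r w * (x : 𝕜) = (1 + (α - x) * w + ω * w ^ 2) / (1 + α * w + ω * w ^ 2) := by
      simp only [hr]
      rw [eq_div_iff hw, sub_mul, mul_right_comm, div_mul_cancel₀ _ hw]
      ring
    rw [e, inv_div]
  refine ⟨fun z => r (l * z), ?_, by simp [hr], ?_, ?_, ht.eventually (hint.mono fun _ h => h.1), ?_⟩
  · simp only [hr]
    refine AnalyticAt.div (by fun_prop) (by fun_prop) (by simp)
  · have hder : HasDerivAt (fun z : 𝕜 => r (l * z)) l 0 := by
      have h1 : HasDerivAt (fun z : 𝕜 => (l : 𝕜) * z) l 0 := by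
        simpa using (hasDerivAt_id (0 : 𝕜)).const_mul (l : 𝕜)
      have h2 : HasDerivAt (fun z : 𝕜 => 1 + (α : 𝕜) * (l * z) + ω * (l * z) ^ 2) ((α : 𝕜) * l) 0 := by
        have := ((h1.const_mul (α : 𝕜)).const_add 1).add ((h1.pow 2).const_mul (ω : 𝕜))
        exact this.congr_deriv (by simp)
      have := h1.div h2 (by simp)
      exact this.congr_deriv (by simp)
    rw [hder.deriv]
    exact hl'
  -- Setting α₀ = ω₁ = 0 turns the numerator E into D, so this family generates (1 - ρx)⁻¹ itself.
  · have hS' : ∀ n, ∫ x, (freeMeixnerPoly (0 : ℝ) α 0 ω n).eval x ^ 2 ∂μ ≤ M' * K' ^ n := hS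
    refine ⟨_, isPreGeneratingFunction_freeMeixnerPoly hμ hM' (by linarith) hS' hl0.ne' (by nlinarith)
      (φ := fun w x => (1 - r w * (x : 𝕜))⁻¹) fun x => ?_⟩
    filter_upwards [hinv x] with w hw
    simpa using hw
  · refine ⟨_, isPreGeneratingFunction_freeMeixnerPoly hμ hM (by linarith) hP hl0.ne' (by nlinarith)
      (φ := fun w x => (1 - r w * (x : 𝕜))⁻¹ / ∫ y : ℝ, (1 - r w * (y : 𝕜))⁻¹ ∂μ) fun x => ?_,
      fun m n hmn => ?_⟩
    · filter_upwards [hinv x, hint, hd0] with w hw hw' hw0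
      -- Dividing D/(D - wx) by D/E leaves E/(D - wx), the generating function of the orthogonal
      -- family.
      have e : ∀ a b c : 𝕜, a ≠ 0 → a / b / (a / c) = c / b := fun a b c ha => by field_simp
      rw [hw, hw'.2, e _ _ _ hw0]
    · change polyInner μ _ _ = 0
      rw [polyInner_C_mul_left, polyInner_C_mul_right]
      have e : ∀ n, freeMeixnerPoly (α₀ : 𝕜) α ω₁ ω n =
          (freeMeixnerPoly α₀ α ω₁ ω n).map (algebraMap ℝ 𝕜) := fun n => by
        rw [map_freeMeixnerPoly]
      rw [e, e, polyInner_map_ofReal, ho m n hmn]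
      simp

theorem mainTheorem1 (𝕜 : Type*) [RCLike 𝕜] (μ : Measure ℝ) [IsProbabilityMeasure μ]
    (hμ : ∀ n : ℕ, Integrable (fun x : ℝ => x ^ n) μ) :
    (MultiplicativeRenormalizationApplies μ (fun t : 𝕜 => (1 - t)⁻¹) ↔ IsFreeMeixner μ) ∧
    (∫ x, x ∂μ = 0 → ∫ x, x ^ 2 ∂μ = 1 →
      (MultiplicativeRenormalizationApplies μ (fun t : 𝕜 => (1 - t)⁻¹) ↔
        ∃ a b : ℝ, IsStandardFreeMeixner a b μ)) := by
  have key : MultiplicativeRenormalizationApplies μ (fun t : 𝕜 => (1 - t)⁻¹) ↔ IsFreeMeixner μ :=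
    ⟨isFreeMeixner_of_multiplicativeRenormalizationApplies hμ,
      multiplicativeRenormalizationApplies_of_isFreeMeixner hμ⟩
  refine ⟨key, fun hm hv => key.trans ⟨exists_isStandardFreeMeixner hμ hm hv, ?_⟩⟩
  rintro ⟨a, b, h⟩
  exact h.isFreeMeixner
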